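/- Let $K$ be an infinite field of arbitrary characteristic, let $m<n$ be positive integers, and let $T=(T_{ijk})_{1\le i\le m,\,1\le j\le n,\,1\le k\le 2}$ be an array of independent indeterminates with polynomial ring $K[T]$. Put $X=(T_{ij1})_{i,j}$ and $Y=(T_{ij2})_{i,j}$. Let $SL(m,K)\times SL(n,K)\times SL(2,K)$ act on $K[T]$ by $K$-algebra automorphisms, where $(P,Q)\in SL(m,K)\times SL(n,K)$ sends $X\mapsto P^{\top}XQ$, $Y\mapsto P^{\top}YQ$, and $\begin{pmatrix}a&b\\c&d\end{pmatrix}\in SL(2,K)$ sends $X\mapsto aX+cY$, $Y\mapsto bX+dY$. Then $$K[T]^{SL(m,K)\times SL(n,K)\times SL(2,K)}=K[T]^{SL(m,K)\times SL(n,K)}.$$ Moreover, let $d=\gcd(m,n)$. If $n=m+d$, then the determinant of the following $(mn/d)\times(mn/d)$ matrix is $SL(2,K)$-invariant: it has $n/d$ block rows of height $m$ and $m/d$ block columns of width $n$, its block in place $(q,q)$ is $X$ and its block in place $(q+1,q)$ is $Y$ for $1\le q\le m/d$, and all its other blocks are zero. -/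

import Mathlib

open MvPolynomial Matrix

noncomputable section

/-- The polynomial ring `K[T]` in the entries of an `m × n × 2`-tensor of indeterminates
`T = (T_{ijk})`; the third index runs over `Fin 2 = {0, 1}`. -/
abbrev TensorRing (m n : ℕ) (K : Type*) [Field K] : Type _ :=
  MvPolynomial (Fin m × Fin n × Fin 2) K

namespace TensorRing

variable {m n : ℕ} {K : Type*} [Field K]

variable (m n K) in
/-- The `k`-th slice `(T_{ijk})_{i,j}` of the tensor of indeterminates:
`slice m n K 0` is the matrix `X` and `slice m n K 1` is the matrix `Y`. -/
def slice (k : Fin 2) : Matrix (Fin m) (Fin n) (TensorRing m n K) :=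
  Matrix.of fun i j => MvPolynomial.X (i, j, k)

variable (m n) in
/-- A matrix over `K`, regarded as a matrix of constant polynomials in `K[T]`. -/
def const {ι κ : Type*} (A : Matrix ι κ K) : Matrix ι κ (TensorRing m n K) :=
  A.map MvPolynomial.C

/-- The `K`-algebra endomorphism with `X ↦ Pᵀ X Q` and `Y ↦ Pᵀ Y Q`. -/
def substPQ (P : Matrix (Fin m) (Fin m) K) (Q : Matrix (Fin n) (Fin n) K) :
    TensorRing m n K →ₐ[K] TensorRing m n K :=
  MvPolynomial.aeval fun t => ((const m n P)ᵀ * slice m n K t.2.2 * const m n Q) t.1 t.2.1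

/-- For `R = (a b; c d)`, the `K`-algebra endomorphism with
`X ↦ a X + c Y` and `Y ↦ b X + d Y`. -/
def substR (R : Matrix (Fin 2) (Fin 2) K) : TensorRing m n K →ₐ[K] TensorRing m n K :=
  MvPolynomial.aeval fun t => (R 0 t.2.2 • slice m n K 0 + R 1 t.2.2 • slice m n K 1) t.1 t.2.1

theorem substPQ_map_slice (P : Matrix (Fin m) (Fin m) K) (Q : Matrix (Fin n) (Fin n) K)
    (k : Fin 2) :
    (slice m n K k).map (substPQ P Q) = (const m n P)ᵀ * slice m n K k * const m n Q := by
  ext1 i j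
  simp [substPQ, slice]

theorem substPQ_map_const {ι κ : Type*} (P : Matrix (Fin m) (Fin m) K)
    (Q : Matrix (Fin n) (Fin n) K) (A : Matrix ι κ K) :
    (const m n A).map (substPQ P Q) = const m n A := by
  ext1 i j
  simp [const, substPQ]

theorem substR_map_slice (R : Matrix (Fin 2) (Fin 2) K) (k : Fin 2) :
    (slice m n K k).map (substR R) = R 0 k • slice m n K 0 + R 1 k • slice m n K 1 := by
  ext1 i j
  simp [substR, slice]

theorem substPQ_X (P : Matrix (Fin m) (Fin m) K) (Q : Matrix (Fin n) (Fin n) K)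
    (i : Fin m) (j : Fin n) (k : Fin 2) :
    substPQ P Q (X (i, j, k)) = ∑ b, ∑ a, C (P a i) * X (a, b, k) * C (Q b j) := by
  simp [substPQ, slice, const, Matrix.mul_apply, Finset.sum_mul]

theorem substR_X (R : Matrix (Fin 2) (Fin 2) K) (i : Fin m) (j : Fin n) (k : Fin 2) :
    substR R (X (i, j, k)) =
      (C (R 0 k) * X (i, j, 0) + C (R 1 k) * X (i, j, 1) : TensorRing m n K) := by
  simp [substR, slice, MvPolynomial.smul_eq_C_mul]

theorem substPQ_mul (P P' : Matrix (Fin m) (Fin m) K) (Q Q' : Matrix (Fin n) (Fin n) K) :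
    substPQ (P * P') (Q * Q') = (substPQ P Q).comp (substPQ P' Q') := by
  refine MvPolynomial.algHom_ext fun ⟨i, j, k⟩ => ?_
  have h : (slice m n K k).map (substPQ (P * P') (Q * Q')) =
      ((slice m n K k).map (substPQ P' Q')).map (substPQ P Q) := by
    rw [substPQ_map_slice, substPQ_map_slice, Matrix.map_mul, Matrix.map_mul,
      Matrix.transpose_map, substPQ_map_const, substPQ_map_const, substPQ_map_slice]
    simp only [const, Matrix.map_mul, Matrix.transpose_mul, Matrix.mul_assoc]
  simpa [slice] using congrFun (congrFun h i) j

/-- The action of `G = SL(m, K) × SL(n, K)` on `K[T]`. -/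
def actG : SpecialLinearGroup (Fin m) K × SpecialLinearGroup (Fin n) K →*
    (TensorRing m n K →ₐ[K] TensorRing m n K) where
  toFun g := substPQ g.1.1 g.2.1
  map_one' := by
    refine MvPolynomial.algHom_ext fun ⟨i, j, k⟩ => ?_
    simp [substPQ, const, slice, Matrix.map_one (C : K →+* TensorRing m n K) C_0 C_1]
  map_mul' g h := substPQ_mul _ _ _ _

/-- The action of `SL(2, K)` on `K[T]`. -/
def actSL2 : SpecialLinearGroup (Fin 2) K →*
    (TensorRing m n K →ₐ[K] TensorRing m n K) where
  toFun R := substR R.1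
  map_one' := by
    refine MvPolynomial.algHom_ext fun ⟨i, j, k⟩ => ?_
    fin_cases k <;> simp [substR_X]
  map_mul' R S := by
    refine MvPolynomial.algHom_ext fun ⟨i, j, k⟩ => ?_
    simp [substR_X, Matrix.mul_apply, Fin.sum_univ_two]
    ring

theorem commute_actG_actSL2
    (g : SpecialLinearGroup (Fin m) K × SpecialLinearGroup (Fin n) K)
    (R : SpecialLinearGroup (Fin 2) K) :
    Commute (actG g : TensorRing m n K →ₐ[K] TensorRing m n K) (actSL2 R) := by
  refine MvPolynomial.algHom_ext fun ⟨i, j, k⟩ => ?_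
  simp only [actG, actSL2, MonoidHom.coe_mk, OneHom.coe_mk, AlgHom.mul_apply, substR_X,
    substPQ_X, map_add, map_mul, map_sum, MvPolynomial.algHom_C, algebraMap_eq,
    Finset.mul_sum, ← Finset.sum_add_distrib]
  refine Finset.sum_congr rfl fun b _ => Finset.sum_congr rfl fun a _ => ?_
  ring

/-- The action of `SL(m, K) × SL(n, K) × SL(2, K)` on `K[T]` in which `((P, Q), R)` acts as the
composite of the two commuting actions of `(P, Q)` and of `R`. -/
def actGSL2 : (SpecialLinearGroup (Fin m) K × SpecialLinearGroup (Fin n) K) ×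
    SpecialLinearGroup (Fin 2) K →* (TensorRing m n K →ₐ[K] TensorRing m n K) :=
  MonoidHom.noncommCoprod actG actSL2 commute_actG_actSL2

/-- The subalgebra `K[T]^H` of invariants of a group `H` acting on `K[T]` by `K`-algebra
homomorphisms. -/
def invariants {H : Type*} [Group H] (ρ : H →* (TensorRing m n K →ₐ[K] TensorRing m n K)) :
    Subalgebra K (TensorRing m n K) where
  carrier := {f | ∀ h : H, ρ h f = f}
  mul_mem' hf hg h := by rw [map_mul, hf h, hg h]
  add_mem' hf hg h := by rw [map_add, hf h, hg h]
  algebraMap_mem' r h := by rw [AlgHom.commutes]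

variable (m n K) in
/-- The `(mn/d) × (mn/d)` matrix, `d = gcd(m, n)`, made of `n/d` block rows of height `m` and
`m/d` block columns of width `n`, with block `X` in the places `(q, q)`, block `Y` in the places
`(q + 1, q)`, and zero blocks elsewhere. -/
def blockMatrix : Matrix (Fin (m * n / m.gcd n)) (Fin (m * n / m.gcd n)) (TensorRing m n K) :=
  Matrix.reindex
    (finProdFinEquiv.trans
      (finCongr (by rw [Nat.div_mul_right_comm (Nat.gcd_dvd_right m n), mul_comm n m])))
    (finProdFinEquiv.trans
      (finCongr (by rw [Nat.div_mul_right_comm (Nat.gcd_dvd_left m n)])))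
    (Matrix.of fun (r : Fin (n / m.gcd n) × Fin m) (c : Fin (m / m.gcd n) × Fin n) =>
      if (r.1 : ℕ) = c.1 then slice m n K 0 r.2 c.2
      else if (r.1 : ℕ) = c.1 + 1 then slice m n K 1 r.2 c.2
      else 0)

end TensorRing

end

/-! The canonical pencil `A` (slices `(I 0)` and `(0 I)`, possible because `m < n`) has no
self-extensions: `(P, Q) ↦ (P * A k - A k * Q)ₖ` is surjective (`exists_mul_canonicalPencil_sub`).
Hence its `GL(m) × GL(n)`-orbit is dense. Algebraically, the identity solution of `P * A k = A k *
Q` lifts to polynomial matrices with `P * A k = slice k * Q` and nonzero determinants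
(`exists_mul_eq_slice_mul`), so every `B` off a hypersurface is `p A q⁻¹`. A transvection `R`
carries `A` to `U A V⁻¹` with `U`, `V` Pascal matrices of determinant 1. Then `R` carries `B` to `(p
U p⁻¹) B (q V⁻¹ q⁻¹)`, in the `SL(m) × SL(n)`-orbit of `B`. So an invariant `f` agrees with `substR
R f` off a hypersurface, hence everywhere as `K` is infinite (`substR_eq_of_canonical`).
Transvections generate `SL(2, K)`. The determinant is covered because it is an `SL(m) ×
SL(n)`-invariant. -/

/-- Solutions of a linear system with polynomial coefficients that is surjective at a point `x`
lift from the point to the polynomial ring. -/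
theorem MvPolynomial.exists_mulVec_eq_zero_of_surjective {σ K α β : Type*} [Field K]
    [Fintype α] [Fintype β] [DecidableEq α] [DecidableEq β]
    (M : Matrix β α (MvPolynomial σ K)) (x : σ → K)
    (hM : Function.Surjective (M.map (eval x)).mulVec) (v₀ : α → K)
    (hv₀ : (M.map (eval x)) *ᵥ v₀ = 0) :
    ∃ v : α → MvPolynomial σ K, M *ᵥ v = 0 ∧ ∀ a, eval x (v a) = v₀ a := by
  obtain ⟨N, hN⟩ := Matrix.mulVec_surjective_iff_exists_right_inverse.mp hM
  have hCe {ι κ : Type _} (A : Matrix ι κ K) : (A.map (C (σ := σ))).map (eval x) = A := by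
    ext i j; simp
  set N' : Matrix α β (MvPolynomial σ K) := N.map C with hN'
  have hdet : eval x (M * N').det = 1 := by
    rw [RingHom.map_det, RingHom.mapMatrix_apply, Matrix.map_mul, hN', hCe, hN, det_one]
  have h1 : eval x ∘ (M *ᵥ (C ∘ v₀)) = 0 := by
    funext b
    have := congrFun hv₀ b
    simpa [Matrix.mulVec, dotProduct, map_sum] using this
  -- Constant lift of `v₀`, scaled by `det (M * N')` and corrected by Cramer's rule without
  -- division. At `x` the scale is 1 and the correction vanishes with `M *ᵥ v₀`.
  refine ⟨(M * N').det • (C ∘ v₀) - N' *ᵥ ((M * N').adjugate *ᵥ (M *ᵥ (C ∘ v₀))), ?_, ?_⟩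
  · rw [mulVec_sub, mulVec_smul, mulVec_mulVec, mulVec_mulVec, mul_adjugate, smul_mulVec,
      one_mulVec, sub_self]
  · intro a
    have h2 : ∀ b, eval x ((M *ᵥ (C ∘ v₀)) b) = 0 := fun b => congrFun h1 b
    have h3 : ∀ b, eval x (((M * N').adjugate *ᵥ (M *ᵥ (C ∘ v₀))) b) = 0 := by
      intro b
      rw [Matrix.mulVec, dotProduct, map_sum]
      exact Finset.sum_eq_zero fun c _ => by rw [map_mul, h2, mul_zero]
    have h4 : eval x ((N' *ᵥ ((M * N').adjugate *ᵥ (M *ᵥ (C ∘ v₀)))) a) = 0 := by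
      rw [Matrix.mulVec, dotProduct, map_sum]
      exact Finset.sum_eq_zero fun c _ => by rw [map_mul, h3, mul_zero]
    simp only [Pi.sub_apply, Pi.smul_apply, smul_eq_mul, map_sub, map_mul, hdet, h4,
      Function.comp_apply, eval_C, one_mul, sub_zero]

namespace TensorRing

/-! ### The canonical pencil and its self-extensions -/

/-- The canonical pencil: the identity matrix followed by zero columns, and the identity matrix
preceded by zero columns. -/
noncomputable def canonicalPencil (m n : ℕ) (K : Type*) [Field K] (k : Fin 2) :
    Matrix (Fin m) (Fin n) K :=
  Matrix.of fun i j => if (j : ℕ) = i + (k : ℕ) * (n - m) then 1 else 0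

variable {m n : ℕ} {K : Type*} [Field K]

theorem mul_canonicalPencil_zero_apply {ι : Type*} (P : Matrix ι (Fin m) K) (i : ι) (j : Fin n) :
    (P * canonicalPencil m n K 0) i j = if h : (j : ℕ) < m then P i ⟨j, h⟩ else 0 := by
  rw [Matrix.mul_apply]
  split_ifs with h
  · rw [Finset.sum_eq_single ⟨j, h⟩]
    · simp [canonicalPencil]
    · intro b _ hb
      have : ¬ (j : ℕ) = b := fun h' => hb (Fin.ext h'.symm)
      simp [canonicalPencil, this]
    · simp
  · refine Finset.sum_eq_zero fun b _ => ?_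
    have : ¬ (j : ℕ) = b := by omega
    simp [canonicalPencil, this]

theorem mul_canonicalPencil_one_apply (hmn : m < n) {ι : Type*} (P : Matrix ι (Fin m) K) (i : ι)
    (j : Fin n) : (P * canonicalPencil m n K 1) i j =
      if h : n - m ≤ (j : ℕ) then P i ⟨j - (n - m), by have := j.2; omega⟩ else 0 := by
  have hj := j.2
  rw [Matrix.mul_apply]
  split_ifs with h
  · rw [Finset.sum_eq_single ⟨j - (n - m), by omega⟩]
    · have : (j : ℕ) - (n - m) + (n - m) = j := Nat.sub_add_cancel h
      simp [canonicalPencil, this]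
    · intro b _ hb
      have : ¬ (j : ℕ) = b + (n - m) := fun h' => hb (Fin.ext (by simp only; omega))
      simp [canonicalPencil, this]
    · simp
  · refine Finset.sum_eq_zero fun b _ => ?_
    have : ¬ (j : ℕ) = b + (n - m) := by omega
    simp [canonicalPencil, this]

theorem add_mul_sub_lt (hmn : m < n) (i : Fin m) (k : Fin 2) :
    (i : ℕ) + (k : ℕ) * (n - m) < n := by
  have := i.2
  fin_cases k <;> simp <;> omega

theorem canonicalPencil_mul_apply (hmn : m < n) (k : Fin 2) {ι : Type*}
    (Q : Matrix (Fin n) ι K) (i : Fin m) (j : ι) :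
    (canonicalPencil m n K k * Q) i j =
      Q ⟨i + (k : ℕ) * (n - m), add_mul_sub_lt hmn i k⟩ j := by
  rw [Matrix.mul_apply, Finset.sum_eq_single ⟨i + (k : ℕ) * (n - m), add_mul_sub_lt hmn i k⟩]
  · simp [canonicalPencil]
  · intro b _ hb
    have : ¬ (b : ℕ) = i + (k : ℕ) * (n - m) := fun h' => hb (Fin.ext h')
    simp [canonicalPencil, this]
  · simp

theorem canonicalPencil_rev (hmn : m < n) (k : Fin 2) :
    (canonicalPencil m n K k).submatrix Fin.rev Fin.rev = canonicalPencil m n K k.rev := by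
  ext i j
  simp only [canonicalPencil, submatrix_apply, of_apply, Fin.val_rev]
  refine if_congr ?_ rfl rfl
  fin_cases k <;> simp <;> omega

/-- The solution of `p (i + r) (j + r) = p i j + D (i + r) (j + r)` that vanishes at the far end
of the diagonal. -/
noncomputable def diagSolveBackward (m r : ℕ) (D : ℕ → ℕ → K) (i j : ℕ) : K :=
  if _h : 0 < r ∧ i + r < m ∧ j < m then
    diagSolveBackward m r D (i + r) (j + r) - D (i + r) (j + r) else 0
termination_by m - j

/-- The solution of `p (i + r) (j + r) = p i j + D (i + r) (j + r)` that vanishes before the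
beginning of the diagonal. -/
noncomputable def diagSolveForward (r : ℕ) (D : ℕ → ℕ → K) (i j : ℕ) : K :=
  (if _h : 0 < r ∧ r ≤ j then diagSolveForward r D (i - r) (j - r) else 0) + D i j
termination_by j

/-- The shift by `(r, r)` preserves `i ≤ j`, so the two boundary conditions never meet on one
diagonal: those with `i ≤ j` are solved from their far end, the others from their start. -/
theorem exists_diagonal_recurrence {m r : ℕ} (hr : 0 < r) (D : ℕ → ℕ → K) :
    ∃ p : ℕ → ℕ → K, (∀ i j, i < m → m ≤ j → p i j = 0) ∧
      (∀ i j, r ≤ i → j < r → p i j = D i j) ∧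
      ∀ i j, i + r < m → j < m → p (i + r) (j + r) = p i j + D (i + r) (j + r) := by
  refine ⟨fun i j => if i ≤ j then diagSolveBackward m r D i j else diagSolveForward r D i j,
    fun i j hi hj => ?_, fun i j hi hj => ?_, fun i j hi hj => ?_⟩
  · simp only [if_pos (hi.le.trans hj)]
    rw [diagSolveBackward, dif_neg (by omega)]
  · simp only [if_neg (not_le.mpr (hj.trans_le hi))]
    rw [diagSolveForward, dif_neg (by omega), zero_add]
  · by_cases h : i ≤ j
    · simp only [if_pos h, add_le_add_iff_right]
      rw [diagSolveBackward.eq_1 m r D i j, dif_pos ⟨hr, hi, hj⟩, sub_add_cancel]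
    · simp only [if_neg h, add_le_add_iff_right]
      rw [diagSolveForward, dif_pos ⟨hr, by omega⟩]
      simp

/-- The canonical pencil has no self-extensions. -/
theorem exists_mul_canonicalPencil_sub (hmn : m < n) (E : Fin 2 → Matrix (Fin m) (Fin n) K) :
    ∃ (P : Matrix (Fin m) (Fin m) K) (Q : Matrix (Fin n) (Fin n) K),
      ∀ k, P * canonicalPencil m n K k - canonicalPencil m n K k * Q = E k := by
  obtain ⟨r, hr, rfl⟩ : ∃ r, 0 < r ∧ n = m + r := ⟨n - m, by omega, by omega⟩
  let e : Fin 2 → ℕ → ℕ → K := fun k i j =>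
    if h : i < m ∧ j < m + r then E k ⟨i, h.1⟩ ⟨j, h.2⟩ else 0
  have he (k : Fin 2) (i : Fin m) (j : Fin (m + r)) : e k i j = E k i j := by
    simp [e]
  obtain ⟨p, h1, h2, h3⟩ := exists_diagonal_recurrence (m := m) hr
    fun i j => e 0 i j - e 1 (i - r) j
  -- Row `i` of slice `k` times `Q` is row `i + k * r` of `Q`. So the equation for slice 0 dictates
  -- rows below `m`, that for slice 1 the rows from `r` on; on the overlap they agree by the
  -- recurrence for `p`.
  let q : ℕ → ℕ → K := fun i j => if i < m then p i j - e 0 i j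
    else (if r ≤ j then p (i - r) (j - r) else 0) - e 1 (i - r) j
  refine ⟨Matrix.of fun i j => p i j, Matrix.of fun i j => q i j, fun k => ?_⟩
  ext i j
  rw [Matrix.sub_apply, canonicalPencil_mul_apply hmn]
  have hi := i.2
  have hj := j.2
  rw [← he]
  fin_cases k
  · simp only [Fin.zero_eta, mul_canonicalPencil_zero_apply, of_apply, q]
    by_cases h : (j : ℕ) < m
    · simp [h]
    · simp [h, h1 i j hi (not_lt.mp h)]
  · simp only [Fin.mk_one, mul_canonicalPencil_one_apply hmn, of_apply, q, one_mul,
      Nat.add_sub_cancel_left]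
    by_cases h : (i : ℕ) + r < m
    · by_cases h' : r ≤ (j : ℕ)
      · have := h3 i (j - r) h (by omega)
        rw [Nat.sub_add_cancel h'] at this
        simp [h, h', this]
        ring
      · simp [h, h', h2 (i + r) j (by omega) (by omega)]
    · simp [h]

/-! ### Evaluation and the dense orbit -/

/-- The value of a polynomial on tensors at the tensor with slices `B 0` and `B 1`. -/
noncomputable def evalAt (B : Fin 2 → Matrix (Fin m) (Fin n) K) : TensorRing m n K →+* K :=
  MvPolynomial.eval fun t => B t.2.2 t.1 t.2.1

@[simp] theorem evalAt_C (B : Fin 2 → Matrix (Fin m) (Fin n) K) (c : K) : evalAt B (C c) = c :=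
  eval_C c

@[simp] theorem evalAt_X (B : Fin 2 → Matrix (Fin m) (Fin n) K) (i : Fin m) (j : Fin n)
    (k : Fin 2) : evalAt B (X (i, j, k)) = B k i j :=
  eval_X _

theorem evalAt_substPQ (B : Fin 2 → Matrix (Fin m) (Fin n) K) (P : Matrix (Fin m) (Fin m) K)
    (Q : Matrix (Fin n) (Fin n) K) (f : TensorRing m n K) :
    evalAt B (substPQ P Q f) = evalAt (fun k => Pᵀ * B k * Q) f := by
  have : (evalAt B).comp (substPQ P Q : TensorRing m n K →ₐ[K] TensorRing m n K).toRingHom =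
      evalAt (fun k => Pᵀ * B k * Q) := by
    refine MvPolynomial.ringHom_ext (fun c => by simp) fun ⟨i, j, k⟩ => ?_
    simp [substPQ_X, Matrix.mul_apply, Finset.sum_mul]
  exact DFunLike.congr_fun this f

theorem evalAt_substR (B : Fin 2 → Matrix (Fin m) (Fin n) K) (R : Matrix (Fin 2) (Fin 2) K)
    (f : TensorRing m n K) :
    evalAt B (substR R f) = evalAt (fun k => R 0 k • B 0 + R 1 k • B 1) f := by
  have : (evalAt B).comp (substR R : TensorRing m n K →ₐ[K] TensorRing m n K).toRingHom =
      evalAt (fun k => R 0 k • B 0 + R 1 k • B 1) := by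
    refine MvPolynomial.ringHom_ext (fun c => by simp) fun ⟨i, j, k⟩ => ?_
    simp [substR_X]
  exact DFunLike.congr_fun this f

theorem eq_zero_of_evalAt_eq_zero [Infinite K] {f : TensorRing m n K}
    (h : ∀ B, evalAt B f = 0) : f = 0 := by
  refine MvPolynomial.funext fun x => ?_
  rw [map_zero]
  exact h fun k => Matrix.of fun i j => x (i, j, k)

theorem evalAt_mul_mul {f : TensorRing m n K}
    (hf : f ∈ invariants (actG (m := m) (n := n) (K := K)))
    (B : Fin 2 → Matrix (Fin m) (Fin n) K) {U : Matrix (Fin m) (Fin m) K}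
    {V : Matrix (Fin n) (Fin n) K} (hU : U.det = 1) (hV : V.det = 1) :
    evalAt (fun k => U * B k * V) f = evalAt B f := by
  have h : substPQ Uᵀ V f = f := hf (⟨Uᵀ, by rw [det_transpose, hU]⟩, ⟨V, hV⟩)
  conv_rhs => rw [← h, evalAt_substPQ, transpose_transpose]

/-- The matrix of the linear map `(P, Q) ↦ (P * A k - slice k * Q)ₖ`. -/
noncomputable def intertwinerMatrix (A : Fin 2 → Matrix (Fin m) (Fin n) K) :
    Matrix (Fin 2 × Fin m × Fin n) ((Fin m × Fin m) ⊕ (Fin n × Fin n)) (TensorRing m n K) :=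
  Matrix.of fun t => Sum.elim
    (fun s => if t.2.1 = s.1 then C (A t.1 s.2 t.2.2) else 0)
    (fun s => if t.2.2 = s.2 then - X (t.2.1, s.1, t.1) else 0)

theorem intertwinerMatrix_mulVec (A : Fin 2 → Matrix (Fin m) (Fin n) K)
    (v : (Fin m × Fin m) ⊕ (Fin n × Fin n) → TensorRing m n K) (k : Fin 2) (i : Fin m)
    (j : Fin n) : (intertwinerMatrix A *ᵥ v) (k, i, j) =
      (Matrix.of (fun a b => v (.inl (a, b))) * const m n (A k) -
        slice m n K k * Matrix.of (fun a b => v (.inr (a, b)))) i j := by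
  simp [intertwinerMatrix, mulVec, dotProduct, Fintype.sum_prod_type, Matrix.mul_apply, slice,
    const, Finset.sum_ite_irrel, ite_mul, sub_eq_add_neg, mul_comm]

theorem intertwinerMatrix_map_evalAt_mulVec (A : Fin 2 → Matrix (Fin m) (Fin n) K)
    (v : (Fin m × Fin m) ⊕ (Fin n × Fin n) → K) (k : Fin 2) (i : Fin m)
    (j : Fin n) : (((intertwinerMatrix A).map (evalAt A)) *ᵥ v) (k, i, j) =
      (Matrix.of (fun a b => v (.inl (a, b))) * A k -
        A k * Matrix.of (fun a b => v (.inr (a, b)))) i j := by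
  simp [intertwinerMatrix, mulVec, dotProduct, Fintype.sum_prod_type, Matrix.mul_apply,
    Finset.sum_ite_irrel, apply_ite (evalAt A), ite_mul, sub_eq_add_neg, mul_comm]

/-- Over the polynomial ring, the generic pencil is related to a pencil without self-extensions
by matrices that specialize to identity matrices. -/
theorem exists_mul_eq_slice_mul (A : Fin 2 → Matrix (Fin m) (Fin n) K)
    (hA : ∀ E : Fin 2 → Matrix (Fin m) (Fin n) K,
      ∃ (P : Matrix (Fin m) (Fin m) K) (Q : Matrix (Fin n) (Fin n) K),
        ∀ k, P * A k - A k * Q = E k) :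
    ∃ (P : Matrix (Fin m) (Fin m) (TensorRing m n K))
      (Q : Matrix (Fin n) (Fin n) (TensorRing m n K)),
      (∀ k, P * const m n (A k) = slice m n K k * Q) ∧
        P.map (evalAt A) = 1 ∧ Q.map (evalAt A) = 1 := by
  have hsurj : Function.Surjective ((intertwinerMatrix A).map (evalAt A)).mulVec := by
    intro w
    obtain ⟨P, Q, h⟩ := hA fun k => Matrix.of fun i j => w (k, i, j)
    refine ⟨Sum.elim (fun s => P s.1 s.2) fun s => Q s.1 s.2, ?_⟩
    ext ⟨k, i, j⟩
    refine (intertwinerMatrix_map_evalAt_mulVec A _ k i j).trans ?_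
    exact congrFun (congrFun (h k) i) j
  have hone : (intertwinerMatrix A).map (evalAt A) *ᵥ
      Sum.elim (fun s => (1 : Matrix (Fin m) (Fin m) K) s.1 s.2)
        (fun s => (1 : Matrix (Fin n) (Fin n) K) s.1 s.2) = 0 := by
    ext ⟨k, i, j⟩
    refine (intertwinerMatrix_map_evalAt_mulVec A _ k i j).trans ?_
    change ((1 : Matrix (Fin m) (Fin m) K) * A k - A k * (1 : Matrix (Fin n) (Fin n) K)) i j = 0
    simp
  obtain ⟨v, hv, hv'⟩ := exists_mulVec_eq_zero_of_surjective _ _ hsurj _ hone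
  refine ⟨Matrix.of fun a b => v (.inl (a, b)), Matrix.of fun a b => v (.inr (a, b)),
    fun k => ?_, ?_, ?_⟩
  · ext1 i j
    rw [← sub_eq_zero, ← Matrix.sub_apply, ← intertwinerMatrix_mulVec, hv, Pi.zero_apply]
  · ext1 a b
    exact hv' _
  · ext1 a b
    exact hv' _

/-- A polynomial invariant takes the same values at `A` and at `(U * A k * V)ₖ`, so if these are
the tensors `A` and `A.R` for a pencil `A` without self-extensions, the invariant is fixed
by `R`. -/
theorem substR_eq_of_canonical [Infinite K] {f : TensorRing m n K}
    (hf : f ∈ invariants (actG (m := m) (n := n) (K := K)))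
    (A : Fin 2 → Matrix (Fin m) (Fin n) K)
    (hA : ∀ E : Fin 2 → Matrix (Fin m) (Fin n) K,
      ∃ (P : Matrix (Fin m) (Fin m) K) (Q : Matrix (Fin n) (Fin n) K),
        ∀ k, P * A k - A k * Q = E k)
    (R : Matrix (Fin 2) (Fin 2) K) (U : Matrix (Fin m) (Fin m) K) (V : Matrix (Fin n) (Fin n) K)
    (hU : U.det = 1) (hV : V.det = 1)
    (hUV : ∀ k, U * A k = (R 0 k • A 0 + R 1 k • A 1) * V) : substR R f = f := by
  obtain ⟨P, Q, hPQ, hP, hQ⟩ := exists_mul_eq_slice_mul A hA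
  have hdetP : evalAt A P.det = 1 := by
    rw [RingHom.map_det, RingHom.mapMatrix_apply, hP, det_one]
  have hdetQ : evalAt A Q.det = 1 := by
    rw [RingHom.map_det, RingHom.mapMatrix_apply, hQ, det_one]
  have hP0 : P.det ≠ 0 := fun h => by simp [h] at hdetP
  have hQ0 : Q.det ≠ 0 := fun h => by simp [h] at hdetQ
  -- The two factors are nonzero polynomials, and they confine the comparison to points where `P`
  -- and `Q` are invertible.
  suffices h : (substR R f - f) * P.det * Q.det = 0 by
    simpa [hP0, hQ0, sub_eq_zero] using h
  refine eq_zero_of_evalAt_eq_zero fun B => ?_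
  simp only [map_mul, mul_eq_zero]
  rw [or_assoc, or_iff_not_imp_right, not_or, map_sub, sub_eq_zero, evalAt_substR,
    RingHom.map_det, RingHom.map_det, RingHom.mapMatrix_apply, RingHom.mapMatrix_apply]
  rintro ⟨hp, hq⟩
  set p := P.map (evalAt B)
  set q := Q.map (evalAt B)
  have hpu : IsUnit p.det := isUnit_iff_ne_zero.mpr hp
  have hqu : IsUnit q.det := isUnit_iff_ne_zero.mpr hq
  have hVu : IsUnit V.det := by rw [hV]; exact isUnit_one
  have hB (k : Fin 2) : p * A k = B k * q := by
    have h1 := congrArg (fun M => M.map (evalAt B)) (hPQ k)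
    simp only [Matrix.map_mul] at h1
    convert h1 using 2
    · ext i j; simp [const]
    · ext i j; simp [slice]
  have hB' (k : Fin 2) : B k = p * A k * q⁻¹ := by
    rw [hB, Matrix.mul_assoc, mul_nonsing_inv _ hqu, Matrix.mul_one]
  -- `p` and `q` need not have determinant 1, but only conjugates of `U` and `V⁻¹` remain.
  have hR (k : Fin 2) : R 0 k • B 0 + R 1 k • B 1 =
      (p * U * p⁻¹) * B k * (q * V⁻¹ * q⁻¹) := by
    have h1 : R 0 k • B 0 + R 1 k • B 1 = p * (R 0 k • A 0 + R 1 k • A 1) * q⁻¹ := by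
      rw [hB' 0, hB' 1]
      simp [Matrix.mul_add, Matrix.add_mul]
    have h2 : R 0 k • A 0 + R 1 k • A 1 = U * A k * V⁻¹ := by
      rw [hUV, Matrix.mul_assoc, mul_nonsing_inv _ hVu, Matrix.mul_one]
    rw [h1, h2, hB' k]
    simp only [Matrix.mul_assoc]
    rw [nonsing_inv_mul_cancel_left _ _ hpu, nonsing_inv_mul_cancel_left _ _ hqu]
  simp only [hR]
  refine evalAt_mul_mul hf B ?_ ?_
  · rw [det_conj_of_mul_eq_one (mul_nonsing_inv _ hpu) (nonsing_inv_mul _ hpu), hU]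
  · rw [det_conj_of_mul_eq_one (mul_nonsing_inv _ hqu) (nonsing_inv_mul _ hqu), det_nonsing_inv,
      hV, Ring.inverse_one]

/-! ### Pascal matrices realizing a transvection -/

/-- The entries of the lower triangular Pascal matrix with parameter `s`, each repeated as a
scalar `r × r` block. -/
noncomputable def pascal (r : ℕ) (s : K) (i j : ℕ) : K :=
  if i % r = j % r then (Nat.choose (i / r) (j / r) : K) * s ^ (i / r - j / r) else 0

theorem pascal_of_lt {r i j : ℕ} (s : K) (hij : i < j) : pascal r s i j = 0 := by
  rw [pascal]
  split_ifs with h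
  · have h1 : i / r < j / r := by
      by_contra! h2
      have h3 := Nat.mul_le_mul_left r h2
      have h4 := Nat.div_add_mod i r
      have h5 := Nat.div_add_mod j r
      omega
    simp [Nat.choose_eq_zero_of_lt h1]
  · rfl

theorem pascal_self (r i : ℕ) (s : K) : pascal r s i i = 1 := by
  simp [pascal]

/-- Within a residue class mod `r`, row `i` lists the coefficients of `(t - c) ^ a`, `a = i / r`.
The identity is `(t - c) ^ (a + 1) + c * (t - c) ^ a = t * (t - c) ^ a`. -/
theorem pascal_add_left {r : ℕ} (hr : 0 < r) (c : K) (i j : ℕ) :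
    pascal r (-c) (i + r) j + c * pascal r (-c) i j =
      if r ≤ j then pascal r (-c) i (j - r) else 0 := by
  have hi : (i + r) / r = i / r + 1 := Nat.add_div_right i hr
  split_ifs with h
  · obtain ⟨j, rfl⟩ := Nat.exists_eq_add_of_le' h
    simp only [pascal, Nat.add_mod_right, hi, Nat.add_div_right j hr, Nat.add_sub_cancel]
    split_ifs
    · rw [Nat.choose_succ_succ, Nat.add_sub_add_right]
      rcases lt_or_ge (i / r) (j / r + 1) with h2 | h2
      · simp [Nat.choose_eq_zero_of_lt h2]
      · obtain ⟨b, hb⟩ := Nat.exists_eq_add_of_le h2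
        have e1 : i / r - j / r = b + 1 := by omega
        have e2 : i / r - (j / r + 1) = b := by omega
        rw [e1, e2]
        push_cast
        ring
    · simp
  · have hj : j / r = 0 := Nat.div_eq_of_lt (not_le.mp h)
    simp only [pascal, Nat.add_mod_right, hi, hj]
    split_ifs
    · simp [pow_succ]; ring
    · simp

/-- The `ℓ × ℓ` matrix with entries `pascal`. -/
noncomputable def pascalMatrix (ℓ r : ℕ) (s : K) : Matrix (Fin ℓ) (Fin ℓ) K :=
  Matrix.of fun i j => pascal r s i j

theorem det_pascalMatrix (ℓ r : ℕ) (s : K) : (pascalMatrix ℓ r s).det = 1 := by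
  rw [det_of_isLowerTriangular (pascalMatrix ℓ r s) fun i j (hij : i < j) => pascal_of_lt s hij]
  exact Finset.prod_eq_one fun i _ => pascal_self r i s

theorem pascalMatrix_mul_canonicalPencil_zero (hmn : m < n) (s : K) :
    pascalMatrix m (n - m) s * canonicalPencil m n K 0 =
      canonicalPencil m n K 0 * pascalMatrix n (n - m) s := by
  ext i j
  rw [mul_canonicalPencil_zero_apply, canonicalPencil_mul_apply hmn]
  simp only [pascalMatrix, of_apply, Fin.val_zero, zero_mul, add_zero]
  split_ifs with h
  · rfl
  · exact (pascal_of_lt s (by omega)).symm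

theorem pascalMatrix_mul_canonicalPencil_one (hmn : m < n) (c : K) :
    pascalMatrix m (n - m) (-c) * canonicalPencil m n K 1 =
      (c • canonicalPencil m n K 0 + canonicalPencil m n K 1) * pascalMatrix n (n - m) (-c) := by
  ext i j
  rw [mul_canonicalPencil_one_apply hmn, Matrix.add_mul, Matrix.smul_mul, Matrix.add_apply,
    Matrix.smul_apply, canonicalPencil_mul_apply hmn, canonicalPencil_mul_apply hmn, add_comm]
  simpa [pascalMatrix] using (pascal_add_left (by omega : 0 < n - m) c i j).symm

/-! ### Invariance of the block determinant -/

open scoped Kronecker in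
theorem det_blockMatrix_mem_invariants_actG :
    (blockMatrix m n K).det ∈ invariants (actG (m := m) (n := n) (K := K)) := by
  rintro ⟨⟨P, hP⟩, ⟨Q, hQ⟩⟩
  change substPQ P Q (blockMatrix m n K).det = (blockMatrix m n K).det
  let b : Fin (n / m.gcd n) → Fin (m / m.gcd n) → Matrix (Fin m) (Fin n) (TensorRing m n K) :=
    fun q p => if (q : ℕ) = p then slice m n K 0 else if (q : ℕ) = p + 1 then slice m n K 1 else 0
  let N : Matrix (Fin (n / m.gcd n) × Fin m) (Fin (m / m.gcd n) × Fin n) (TensorRing m n K) :=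
    Matrix.of fun r c => b r.1 c.1 r.2 c.2
  obtain ⟨e₁, e₂, he⟩ : ∃ e₁ e₂, blockMatrix m n K = reindex e₁ e₂ N := by
    refine ⟨_, _, congrArg (reindex _ _) ?_⟩
    ext1 r c
    simp only [N, b, of_apply]
    split_ifs <;> rfl
  have hb (q p) : (b q p).map (substPQ P Q) = (const m n P)ᵀ * b q p * const m n Q := by
    simp only [b]
    split_ifs
    · exact substPQ_map_slice P Q 0
    · exact substPQ_map_slice P Q 1
    · ext i j; simp
  have hN : N.map (substPQ P Q) = ((1 : Matrix (Fin (n / m.gcd n)) (Fin (n / m.gcd n)) _) ⊗ₖ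
      (const m n P)ᵀ) * N * ((1 : Matrix (Fin (m / m.gcd n)) (Fin (m / m.gcd n)) _) ⊗ₖ
      const m n Q) := by
    ext1 ⟨q, i⟩ ⟨p, j⟩
    refine (congrFun (congrFun (hb q p) i) j).trans ?_
    simp [Matrix.mul_apply, N, Fintype.sum_prod_type, Matrix.one_apply, ite_mul,
      Finset.sum_ite_irrel]
  have hdet {ι : Type} [Fintype ι] [DecidableEq ι] (A : Matrix ι ι K) (hA : A.det = 1) :
      (const m n A).det = 1 := by
    have := (RingHom.map_det (C : K →+* TensorRing m n K) A).symm
    rwa [hA, map_one] at this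
  rw [AlgHom.map_det, AlgHom.mapMatrix_apply, he]
  -- Using `e₁` on both sides of the left factor and `e₂` on both sides of the right one makes all
  -- three factors square over one index type.
  have h1 : (reindex e₁ e₂ N).map (substPQ P Q) = reindex e₁ e₁ (1 ⊗ₖ (const m n P)ᵀ) *
      reindex e₁ e₂ N * reindex e₂ e₂ (1 ⊗ₖ const m n Q) := by
    simp only [reindex_apply, submatrix_mul_equiv, ← submatrix_map, hN]
  rw [h1, det_mul, det_mul, det_reindex_self, det_reindex_self, det_kronecker, det_kronecker,
    det_transpose, hdet P hP, hdet Q hQ]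
  simp

/-! ### From transvections to `SL(2, K)` -/

variable [Infinite K] {f : TensorRing m n K}

theorem substR_upperTransvection (hmn : m < n)
    (hf : f ∈ invariants (actG (m := m) (n := n) (K := K))) (c : K) :
    substR !![1, c; 0, 1] f = f := by
  refine substR_eq_of_canonical hf (canonicalPencil m n K) (exists_mul_canonicalPencil_sub hmn) _
    (pascalMatrix m (n - m) (-c)) (pascalMatrix n (n - m) (-c)) (det_pascalMatrix _ _ _)
    (det_pascalMatrix _ _ _) fun k => ?_
  fin_cases k
  · simpa using pascalMatrix_mul_canonicalPencil_zero hmn (-c)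
  · simpa using pascalMatrix_mul_canonicalPencil_one hmn c

/-- Reversing rows and columns swaps the slices of the canonical pencil, turning the upper case into
this one. -/
theorem substR_lowerTransvection (hmn : m < n)
    (hf : f ∈ invariants (actG (m := m) (n := n) (K := K))) (c : K) :
    substR !![1, 0; c, 1] f = f := by
  refine substR_eq_of_canonical hf (canonicalPencil m n K) (exists_mul_canonicalPencil_sub hmn) _
    ((pascalMatrix m (n - m) (-c)).submatrix Fin.revPerm Fin.revPerm)
    ((pascalMatrix n (n - m) (-c)).submatrix Fin.revPerm Fin.revPerm)
    ((det_submatrix_equiv_self _ _).trans (det_pascalMatrix _ _ _))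
    ((det_submatrix_equiv_self _ _).trans (det_pascalMatrix _ _ _)) fun k => ?_
  have h0 : canonicalPencil m n K 0 =
      (canonicalPencil m n K 1).submatrix Fin.revPerm Fin.revPerm :=
    (canonicalPencil_rev hmn 1).symm
  have h1 : canonicalPencil m n K 1 =
      (canonicalPencil m n K 0).submatrix Fin.revPerm Fin.revPerm :=
    (canonicalPencil_rev hmn 0).symm
  fin_cases k
  · have := congrArg (fun M => M.submatrix Fin.revPerm Fin.revPerm)
      (pascalMatrix_mul_canonicalPencil_one (K := K) hmn c)
    simp only [← submatrix_mul_equiv _ _ _ Fin.revPerm, submatrix_add, submatrix_smul,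
      Pi.add_apply, Pi.smul_apply, ← h0, ← h1] at this
    simpa [add_comm] using this
  · have := congrArg (fun M => M.submatrix Fin.revPerm Fin.revPerm)
      (pascalMatrix_mul_canonicalPencil_zero (K := K) hmn (-c))
    simp only [← submatrix_mul_equiv _ _ _ Fin.revPerm, ← h1] at this
    simpa using this

/-- Every `SL(m, K) × SL(n, K)`-invariant is `SL(2, K)`-invariant. -/
theorem actSL2_apply_of_mem_invariants_actG (hmn : m < n)
    (hf : f ∈ invariants (actG (m := m) (n := n) (K := K))) (R : SpecialLinearGroup (Fin 2) K) :
    actSL2 R f = f := by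
  have hlow (c : K) := substR_lowerTransvection hmn hf c
  have hup (c : K) := substR_upperTransvection hmn hf c
  have hmul (R S : Matrix (Fin 2) (Fin 2) K) (g : TensorRing m n K) :
      substR (R * S) g = substR R (substR S g) := by
    have : (substR (R * S) : TensorRing m n K →ₐ[K] _) = (substR R).comp (substR S) := by
      refine MvPolynomial.algHom_ext fun ⟨i, j, k⟩ => ?_
      simp [substR_X, Matrix.mul_apply, Fin.sum_univ_two]
      ring
    exact DFunLike.congr_fun this g
  have hne (R : Matrix (Fin 2) (Fin 2) K) (hdet : R.det = 1) (hc : R 1 0 ≠ 0) :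
      substR R f = f := by
    have hR : R = !![1, (R 0 0 - 1) / R 1 0; 0, 1] * !![1, 0; R 1 0, 1] *
        !![1, (R 1 1 - 1) / R 1 0; 0, 1] := by
      rw [det_fin_two] at hdet
      ext i j
      fin_cases i <;> fin_cases j <;> simp [Matrix.mul_apply, Fin.sum_univ_two] <;> field_simp
      · ring
      · linear_combination -hdet
      · ring
    rw [hR, hmul, hmul, hup, hlow, hup]
  change substR R.1 f = f
  by_cases hc : R.1 1 0 = 0
  · have hdet := R.2
    have hd : R.1 1 1 ≠ 0 := by
      intro hd
      rw [det_fin_two, hc, hd] at hdet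
      simp at hdet
    -- A lower transvection on the right moves the nonzero entry `R 1 1` into the vanishing lower
    -- left corner.
    have h2 := hne (R.1 * !![1, 0; 1, 1]) (by rw [det_mul, hdet]; simp)
      (by simpa [Matrix.mul_apply, Fin.sum_univ_two, hc] using hd)
    rwa [hmul, hlow] at h2
  · exact hne R.1 R.2 hc

end TensorRing

theorem mainTheorem3 {K : Type*} [Field K] [Infinite K] (m n : ℕ) (hmn : m < n) :
    TensorRing.invariants (TensorRing.actGSL2 (m := m) (n := n) (K := K)) =
      TensorRing.invariants (TensorRing.actG (m := m) (n := n) (K := K)) ∧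
    (n = m + m.gcd n →
      (TensorRing.blockMatrix m n K).det ∈
        TensorRing.invariants (TensorRing.actSL2 (m := m) (n := n) (K := K))) := by
  refine ⟨le_antisymm (fun f hf g => ?_) fun f hf g => ?_, fun _ R => ?_⟩
  · simpa [TensorRing.actGSL2] using hf (g, 1)
  · have h : TensorRing.actG g.1 (TensorRing.actSL2 g.2 f) = f := by
      rw [TensorRing.actSL2_apply_of_mem_invariants_actG hmn hf, hf]
    exact h
  · exact TensorRing.actSL2_apply_of_mem_invariants_actG hmn
      TensorRing.det_blockMatrix_mem_invariants_actG R
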